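/- Let $n,m\ge 1$ be integers. The $n$-dimensional $m$-Catalan arrangement consists of the hyperplanes of $\mathbb R^n$ with equations $x_i-x_j=a$, where $1\le i<j\le n$ and $a\in\mathbb Z$, $-m\le a\le m$; its regions are the connected components of the complement of the union of these hyperplanes. A region $R$ is relatively bounded if $R\cap\{x\in\mathbb R^n: x_1+\dots+x_n=0\}$ is bounded. The Pak--Stanley label $\lambda(R)\in\mathbb Z_{>0}^n$ of a region $R$ is defined as follows. The region $R_0=\{x : x_1>x_2>\dots>x_n>x_1-1\}$ (the whole line if $n=1$) has label $(1,\dots,1)$. If $R_1$ and $R_2$ are regions separated by a unique hyperplane $H$ of the arrangement, with equation $x_i-x_j=a$ ($i<j$), and $R_0$ and $R_1$ lie on the same side of $H$, then $\lambda(R_2)$ is obtained from $\lambda(R_1)$ by increasing by $1$ the $j$-th coordinate if $a>0$, and the $i$-th coordinate if $a\le 0$. (Equivalently, $\lambda(R)_r$ is $1$ plus the number of hyperplanes $x_i-x_j=a$, $i<j$, of the arrangement that separate $R_0$ from $R$ and for which $r=j$ if $a>0$, $r=i$ if $a\le0$.) For $\mathbf a=(a_1,\dots,a_n)\in\mathbb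 Z_{>0}^n$ and $p\in\mathbb Z$, let $Z_p(\mathbf a)$ be the largest subset $\{x_1>x_2>\dots>x_q\}$ of $\{1,\dots,n\}$ such that $a_{x_j}\le p+j$ for every $j\in\{1,\dots,q\}$, and let $z_p(\mathbf a)=|Z_p(\mathbf a)|$. An $m$-Catalan function of dimension $n$ is an $\mathbf a\in\mathbb Z_{>0}^n$ such that $z_{(i-1)m}(\mathbf a)\ge i$ for every $i\in\{1,\dots,n\}$. It is called prime if moreover $z_{(i-1)m-1}(\mathbf a)\ge i$ for every $i\in\{2,\dots,n\}$. **Proposition.** The set of Pak--Stanley labels of the relatively bounded regions of the $n$-dimensional $m$-Catalan arrangement is exactly the set of prime $m$-Catalan functions of dimension $n$. -/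

import Mathlib

namespace MCatalan

open Set

/-! ### The arrangement -/

/-- The triple `(i, j, a)` encodes the affine hyperplane `x i - x j = a` of `ℝⁿ`; this is the
affine function `x i - x j - a` whose zero set is that hyperplane. -/
def hval {n : ℕ} (H : Fin n × Fin n × ℤ) (x : Fin n → ℝ) : ℝ :=
  x H.1 - x H.2.1 - (H.2.2 : ℝ)

/-- The hyperplanes of the `n`-dimensional `(k, l)`-Coxeter arrangement:
`x i - x j = a` with `i < j` and `-l ≤ a ≤ k`. (Distinct triples give distinct hyperplanes.) -/
noncomputable def coxeter (n k l : ℕ) : Finset (Fin n × Fin n × ℤ) :=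
  ((Finset.univ : Finset (Fin n)) ×ˢ (Finset.univ : Finset (Fin n)) ×ˢ
    Finset.Icc (-(l : ℤ)) (k : ℤ)).filter (fun H => H.1 < H.2.1)

/-- The `n`-dimensional `m`-Catalan arrangement is the `(m, m)`-Coxeter arrangement. -/
noncomputable def catalan (n m : ℕ) : Finset (Fin n × Fin n × ℤ) := coxeter n m m

/-- The complement of the union of the hyperplanes of `A`. -/
def complement {n : ℕ} (A : Finset (Fin n × Fin n × ℤ)) : Set (Fin n → ℝ) :=
  {x | ∀ H ∈ A, hval H x ≠ 0}

/-- The regions: the connected components of the complement of the union of the hyperplanes. -/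
def regions {n : ℕ} (A : Finset (Fin n × Fin n × ℤ)) : Set (Set (Fin n → ℝ)) :=
  {R | ∃ x ∈ complement A, R = connectedComponentIn (complement A) x}

/-- `R` is relatively bounded: its intersection with the space `∑ i, x i = 0`, the orthogonal
complement of the line `ℝ (1, …, 1)` of directions common to all hyperplanes, is bounded. -/
def IsRelativelyBounded {n : ℕ} (R : Set (Fin n → ℝ)) : Prop :=
  Bornology.IsBounded (R ∩ {x | ∑ i, x i = 0})

/-! ### The Pak–Stanley labeling -/

/-- The region `R₀`, given by `x 1 > x 2 > ⋯ > x n > x 1 - 1`. -/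
def baseRegion (n : ℕ) : Set (Fin n → ℝ) :=
  {x | (∀ i j, i < j → x j < x i) ∧ ∀ i j, x i - x j < 1}

/-- `R` and `S` lie on opposite open sides of the hyperplane `H`. -/
def Separates {n : ℕ} (H : Fin n × Fin n × ℤ) (R S : Set (Fin n → ℝ)) : Prop :=
  ∀ x ∈ R, ∀ y ∈ S, hval H x * hval H y < 0

/-- `R` and `S` lie on the same open side of the hyperplane `H`. -/
def SameSide {n : ℕ} (H : Fin n × Fin n × ℤ) (R S : Set (Fin n → ℝ)) : Prop :=
  ∀ x ∈ R, ∀ y ∈ S, 0 < hval H x * hval H y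

/-- The coordinate of the label that increases when the hyperplane `x i - x j = a` (`i < j`) is
crossed away from `R₀`: the coordinate `j` if `a > 0`, and the coordinate `i` if `a ≤ 0`. -/
def incrCoord {n : ℕ} (H : Fin n × Fin n × ℤ) : Fin n :=
  if 0 < H.2.2 then H.2.1 else H.1

/-- The defining rules of the Pak–Stanley labeling `lab` of the regions of `A`:
`R₀` is labeled `(1, …, 1)`, and if `R₁`, `R₂` are separated by a unique hyperplane `H` of `A`, and
`R₀`, `R₁` are on the same side of `H`, then the label of `R₂` is the label of `R₁` with the
coordinate `incrCoord H` increased by `1`. -/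
structure IsPakStanleyLabeling {n : ℕ} (A : Finset (Fin n × Fin n × ℤ))
    (lab : Set (Fin n → ℝ) → Fin n → ℕ) : Prop where
  base : ∀ r, lab (baseRegion n) r = 1
  step : ∀ R₁ ∈ regions A, ∀ R₂ ∈ regions A, ∀ H ∈ A,
    (∀ H' ∈ A, Separates H' R₁ R₂ ↔ H' = H) → SameSide H (baseRegion n) R₁ →
    ∀ r, lab R₂ r = lab R₁ r + if r = incrCoord H then 1 else 0

open Classical in
/-- The Pak–Stanley label of the region `R` of the arrangement `A`: the coordinate `r` is `1` plus
the number of hyperplanes of `A` that separate `R₀` from `R` and that increase the coordinate `r`.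
By `isPakStanleyLabeling` and `IsPakStanleyLabeling.unique` below, this is the unique labeling of
the regions obeying the defining rules. -/
noncomputable def pakStanleyLabel {n : ℕ} (A : Finset (Fin n × Fin n × ℤ))
    (R : Set (Fin n → ℝ)) (r : Fin n) : ℕ :=
  1 + (A.filter (fun H => Separates H (baseRegion n) R ∧ incrCoord H = r)).card

/-! ### Centers and prime `m`-Catalan functions -/

/-- Writing `X = {x₁ > x₂ > ⋯ > x_q}`, the condition `a (x_j) ≤ p + j` for all `j`. (The element `x`
of `X` is the `j`-th largest one for `j = #{y ∈ X | x ≤ y}`.) -/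
def CenterCondition {n : ℕ} (p : ℤ) (a : Fin n → ℕ) (X : Finset (Fin n)) : Prop :=
  ∀ x ∈ X, (a x : ℤ) ≤ p + ((X.filter (fun y => x ≤ y)).card : ℤ)

open Classical in
/-- The `p`-center `Z_p(a)`: the largest set satisfying `CenterCondition p a`, obtained as the union
of all such sets (see `isGreatest_center`). -/
noncomputable def center {n : ℕ} (p : ℤ) (a : Fin n → ℕ) : Finset (Fin n) :=
  (Finset.univ.filter (fun X : Finset (Fin n) => CenterCondition p a X)).sup id

theorem isGreatest_center {n : ℕ} (p : ℤ) (a : Fin n → ℕ) :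
    IsGreatest {X : Finset (Fin n) | CenterCondition p a X} (center p a) := by
  classical
  have hle : ∀ X : Finset (Fin n), CenterCondition p a X → X ≤ center p a := by
    intro X hX
    exact Finset.le_sup (f := id) (by simpa using hX)
  refine ⟨?_, fun X hX => hle X hX⟩
  intro x hx
  obtain ⟨X, hX, hxX⟩ := Finset.mem_sup.1 hx
  have hX' : CenterCondition p a X := by simpa using hX
  have h1 := hX' x hxX
  have h2 : (X.filter (fun y => x ≤ y)).card ≤ ((center p a).filter (fun y => x ≤ y)).card :=
    Finset.card_le_card (Finset.filter_subset_filter _ (hle X hX'))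
  have h3 : ((X.filter (fun y => x ≤ y)).card : ℤ) ≤
    (((center p a).filter (fun y => x ≤ y)).card : ℤ) := by exact_mod_cast h2
  linarith

/-- `z_p(a)`, the size of the `p`-center. -/
noncomputable def centerCard {n : ℕ} (p : ℤ) (a : Fin n → ℕ) : ℕ := (center p a).card

/-- An `m`-Catalan function of dimension `n`: an `n`-tuple of positive integers such that
`z_{(i-1)m}(a) ≥ i` for all `i ∈ [1, n]`. -/
def IsCatalanFunction {n : ℕ} (m : ℕ) (a : Fin n → ℕ) : Prop :=
  (∀ r, 1 ≤ a r) ∧ ∀ i : ℕ, 1 ≤ i → i ≤ n → i ≤ centerCard (((i : ℤ) - 1) * m) a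

/-- A prime `m`-Catalan function: an `m`-Catalan function such that
`z_{(i-1)m-1}(a) ≥ i` for all `i ∈ [2, n]`. -/
def IsPrimeCatalanFunction {n : ℕ} (m : ℕ) (a : Fin n → ℕ) : Prop :=
  IsCatalanFunction m a ∧ ∀ i : ℕ, 2 ≤ i → i ≤ n → i ≤ centerCard (((i : ℤ) - 1) * m - 1) a

/-! ### The labeling is determined by its defining rules -/

theorem continuous_hval {n : ℕ} (H : Fin n × Fin n × ℤ) : Continuous (hval H) := by
  unfold hval; fun_prop

theorem hval_segment {n : ℕ} (H : Fin n × Fin n × ℤ) (x y : Fin n → ℝ) (t : ℝ) :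
    hval H (fun r => (1 - t) * x r + t * y r) = (1 - t) * hval H x + t * hval H y := by
  unfold hval; ring

/-- The region of a point consists of the points on the same side of all hyperplanes. -/
theorem mem_component_iff {n : ℕ} {A : Finset (Fin n × Fin n × ℤ)} {x : Fin n → ℝ}
    (hx : x ∈ complement A) (y : Fin n → ℝ) :
    y ∈ connectedComponentIn (complement A) x ↔ ∀ H ∈ A, 0 < hval H x * hval H y := by
  constructor
  · intro hy H hH
    by_contra hcon
    have hpre : IsPreconnected (connectedComponentIn (complement A) x) :=
      isPreconnected_connectedComponentIn
    have hsub := connectedComponentIn_subset (complement A) x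
    have hxm := mem_connectedComponentIn hx
    have h0 : ∃ w ∈ connectedComponentIn (complement A) x, hval H w = 0 := by
      have hi := hpre.image (hval H) (continuous_hval H).continuousOn
      have hoc := hi.ordConnected
      have hxne := hx H hH
      rcases lt_or_gt_of_ne hxne with h | h
      · have : 0 ≤ hval H y := by nlinarith
        exact hoc.out ⟨x, hxm, rfl⟩ ⟨y, hy, rfl⟩ ⟨h.le, this⟩
      · have : hval H y ≤ 0 := by nlinarith
        exact hoc.out ⟨y, hy, rfl⟩ ⟨x, hxm, rfl⟩ ⟨this, h.le⟩
    obtain ⟨w, hw, hw0⟩ := h0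
    exact hsub hw H hH hw0
  · intro hy
    have hconv : Convex ℝ {y : Fin n → ℝ | ∀ H ∈ A, 0 < hval H x * hval H y} := by
      intro u hu v hv s t hs ht hst H hH
      have hu' := hu H hH
      have hv' := hv H hH
      have he : hval H (s • u + t • v) = s * hval H u + t * hval H v := by
        simp only [hval, Pi.add_apply, Pi.smul_apply, smul_eq_mul]
        have : s = 1 - t := by linarith
        subst this; ring
      rw [he]
      rcases hs.eq_or_lt with h | h
      · have : t = 1 := by linarith
        subst this; subst h; simpa using hv'
      · have := mul_pos h hu'
        have := mul_nonneg ht hv'.le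
        nlinarith
    refine hconv.isPreconnected.subset_connectedComponentIn ?_ ?_ hy
    · intro H hH
      exact mul_self_pos.2 (hx H hH)
    · intro w hw H hH h0
      have := hw H hH
      rw [h0] at this
      simp at this

theorem baseRegion_side {n k l : ℕ} {H : Fin n × Fin n × ℤ} (hH : H ∈ coxeter n k l)
    {x : Fin n → ℝ} (hx : x ∈ baseRegion n) :
    (0 < H.2.2 ∧ hval H x < 0) ∨ (H.2.2 ≤ 0 ∧ 0 < hval H x) := by
  have hlt : H.1 < H.2.1 := (Finset.mem_filter.1 hH).2
  have h1 := hx.1 _ _ hlt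
  have h2 := hx.2 H.1 H.2.1
  unfold hval
  rcases lt_or_ge 0 H.2.2 with h | h
  · left
    have : (1 : ℝ) ≤ (H.2.2 : ℝ) := by exact_mod_cast h
    exact ⟨h, by linarith⟩
  · right
    have : (H.2.2 : ℝ) ≤ 0 := by exact_mod_cast h
    exact ⟨h, by linarith⟩

theorem baseRegion_nonempty (n : ℕ) : (baseRegion n).Nonempty := by
  refine ⟨fun i => -((i : ℕ) : ℝ) / ((n : ℝ) + 1), ?_, ?_⟩
  · intro i j hij
    have : ((i : ℕ) : ℝ) < ((j : ℕ) : ℝ) := by exact_mod_cast hij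
    have hn : (0 : ℝ) < (n : ℝ) + 1 := by positivity
    exact div_lt_div_of_pos_right (by linarith) hn
  · intro i j
    have hn : (0 : ℝ) < (n : ℝ) + 1 := by positivity
    have hj : ((j : ℕ) : ℝ) < (n : ℝ) := by exact_mod_cast j.2
    have hi : (0 : ℝ) ≤ ((i : ℕ) : ℝ) := by positivity
    rw [← sub_div, div_lt_one hn]
    linarith

/-- `R₀` is a region as soon as the hyperplanes `x i - x j = 0` and `x i - x j = 1` are present. -/
theorem baseRegion_mem_regions {n k l : ℕ} (hk : 0 < k) :
    baseRegion n ∈ regions (coxeter n k l) := by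
  obtain ⟨x, hx⟩ := baseRegion_nonempty n
  have hxc : x ∈ complement (coxeter n k l) := by
    intro H hH
    rcases baseRegion_side hH hx with h | h
    · exact h.2.ne
    · exact h.2.ne'
  refine ⟨x, hxc, ?_⟩
  ext y
  rw [mem_component_iff hxc]
  constructor
  · intro hy H hH
    rcases baseRegion_side hH hx with h | h <;> rcases baseRegion_side hH hy with h' | h'
    · exact mul_pos_of_neg_of_neg h.2 h'.2
    · omega
    · omega
    · exact mul_pos h.2 h'.2
  · intro h
    have hmem : ∀ i j : Fin n, i < j → ∀ c : ℤ, -(l : ℤ) ≤ c → c ≤ k → (i, j, c) ∈ coxeter n k l := by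
      intro i j hij c h1 h2
      simp [coxeter, hij, h1, h2]
    have hA : ∀ i j, i < j → y j < y i := by
      intro i j hij
      have h1 := h _ (hmem i j hij 0 (by omega) (by omega))
      have h2 := hx.1 i j hij
      simp only [hval, Int.cast_zero, sub_zero] at h1
      have := (mul_pos_iff_of_pos_left (sub_pos.2 h2)).1 h1
      linarith
    refine ⟨hA, ?_⟩
    intro i j
    rcases lt_or_ge i j with hij | hij
    · have h1 := h _ (hmem i j hij 1 (by omega) (by omega))
      have h2 := hx.2 i j
      simp only [hval, Int.cast_one] at h1
      by_contra hcon
      nlinarith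
    · rcases hij.eq_or_lt with h0 | h0
      · subst h0; simp
      · have := hA _ _ h0
        linarith

theorem hval_ne_zero_of_mem {n : ℕ} {A : Finset (Fin n × Fin n × ℤ)} {R : Set (Fin n → ℝ)}
    (hR : R ∈ regions A) {x : Fin n → ℝ} (hx : x ∈ R) : x ∈ complement A := by
  obtain ⟨w, hw, rfl⟩ := hR
  exact connectedComponentIn_subset _ _ hx

theorem eq_component {n : ℕ} {A : Finset (Fin n × Fin n × ℤ)} {R : Set (Fin n → ℝ)}
    (hR : R ∈ regions A) {x : Fin n → ℝ} (hx : x ∈ R) :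
    R = connectedComponentIn (complement A) x := by
  obtain ⟨w, hw, rfl⟩ := hR
  exact connectedComponentIn_eq hx

theorem region_nonempty {n : ℕ} {A : Finset (Fin n × Fin n × ℤ)} {R : Set (Fin n → ℝ)}
    (hR : R ∈ regions A) : R.Nonempty := by
  obtain ⟨w, hw, rfl⟩ := hR
  exact ⟨w, mem_connectedComponentIn hw⟩

/-- Separation of regions can be tested on single points. -/
theorem separates_iff {n : ℕ} {A : Finset (Fin n × Fin n × ℤ)} {R S : Set (Fin n → ℝ)}
    (hR : R ∈ regions A) (hS : S ∈ regions A) {H : Fin n × Fin n × ℤ} (hH : H ∈ A)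
    {x y : Fin n → ℝ} (hx : x ∈ R) (hy : y ∈ S) :
    Separates H R S ↔ hval H x * hval H y < 0 := by
  refine ⟨fun h => h x hx y hy, fun h u hu v hv => ?_⟩
  rw [eq_component hR hx, mem_component_iff (hval_ne_zero_of_mem hR hx)] at hu
  rw [eq_component hS hy, mem_component_iff (hval_ne_zero_of_mem hS hy)] at hv
  have h1 := hu H hH
  have h2 := hv H hH
  by_contra hcon
  have h3 := mul_pos h1 h2
  have h4 : hval H x * hval H y * (hval H u * hval H v) ≤ 0 :=
    mul_nonpos_of_nonpos_of_nonneg h.le (not_lt.1 hcon)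
  nlinarith

theorem sameSide_iff {n : ℕ} {A : Finset (Fin n × Fin n × ℤ)} {R S : Set (Fin n → ℝ)}
    (hR : R ∈ regions A) (hS : S ∈ regions A) {H : Fin n × Fin n × ℤ} (hH : H ∈ A) :
    SameSide H R S ↔ ¬ Separates H R S := by
  obtain ⟨x, hx⟩ := region_nonempty hR
  obtain ⟨y, hy⟩ := region_nonempty hS
  rw [separates_iff hR hS hH hx hy, not_lt]
  constructor
  · intro h; exact (h x hx y hy).le
  · intro h u hu v hv
    have h1 := hval_ne_zero_of_mem hR hu H hH
    have h2 := hval_ne_zero_of_mem hS hv H hH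
    rcases lt_or_gt_of_ne (mul_ne_zero h1 h2) with h3 | h3
    · have := ((separates_iff hR hS hH hu hv).2 h3) x hx y hy
      linarith
    · exact h3

/-- Crossing the unique hyperplane `H` away from `B` adds `H` to the separating hyperplanes. -/
theorem separates_step {n : ℕ} {A : Finset (Fin n × Fin n × ℤ)} {B R₁ R₂ : Set (Fin n → ℝ)}
    (hB : B ∈ regions A) (h₁ : R₁ ∈ regions A) (h₂ : R₂ ∈ regions A)
    {H : Fin n × Fin n × ℤ} (huniq : ∀ H' ∈ A, Separates H' R₁ R₂ ↔ H' = H)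
    (hsame : SameSide H B R₁) :
    ∀ H' ∈ A, (Separates H' B R₂ ↔ Separates H' B R₁ ∨ H' = H) := by
  obtain ⟨b, hb⟩ := region_nonempty hB
  obtain ⟨x, hx⟩ := region_nonempty h₁
  obtain ⟨y, hy⟩ := region_nonempty h₂
  intro H' hH'
  rw [separates_iff hB h₂ hH' hb hy, separates_iff hB h₁ hH' hb hx]
  have hu := huniq H' hH'
  rw [separates_iff h₁ h₂ hH' hx hy] at hu
  have e1 := hval_ne_zero_of_mem hB hb H' hH'
  have e2 := hval_ne_zero_of_mem h₁ hx H' hH'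
  have e3 := hval_ne_zero_of_mem h₂ hy H' hH'
  by_cases he : H' = H
  · have h4 := hu.2 he
    have h5 := hsame b hb x hx
    simp only [he, or_true, iff_true]
    rw [he] at h4
    rw [mul_neg_iff] at h4 ⊢
    rw [mul_pos_iff] at h5
    rcases h4 with h4 | h4 <;> rcases h5 with h5 | h5
    · left; exact ⟨h5.1, h4.2⟩
    · linarith [h4.1, h5.2]
    · linarith [h4.1, h5.2]
    · right; exact ⟨h5.1, h4.2⟩
  · have h4 : ¬ hval H' x * hval H' y < 0 := fun h => he (hu.1 h)
    have h5 : 0 < hval H' x * hval H' y :=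
      lt_of_le_of_ne (not_lt.1 h4) (mul_ne_zero e2 e3).symm
    simp only [he, or_false]
    rw [mul_pos_iff] at h5
    rw [mul_neg_iff, mul_neg_iff]
    rcases h5 with h5 | h5
    · constructor
      · rintro (h | h)
        · linarith [h.2, h5.2]
        · exact Or.inr ⟨h.1, h5.1⟩
      · rintro (h | h)
        · linarith [h.2, h5.1]
        · exact Or.inr ⟨h.1, h5.2⟩
    · constructor
      · rintro (h | h)
        · exact Or.inl ⟨h.1, h5.1⟩
        · linarith [h.2, h5.2]
      · rintro (h | h)
        · exact Or.inl ⟨h.1, h5.2⟩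
        · linarith [h.2, h5.1]

/-- The label `pakStanleyLabel` obeys the defining rules of the Pak–Stanley labeling. -/
theorem isPakStanleyLabeling {n k l : ℕ} (hk : 0 < k) :
    IsPakStanleyLabeling (coxeter n k l) (pakStanleyLabel (coxeter n k l)) := by
  classical
  have hB : baseRegion n ∈ regions (coxeter n k l) := baseRegion_mem_regions hk
  obtain ⟨b, hb⟩ := baseRegion_nonempty n
  constructor
  · intro r
    have : ∀ H ∈ coxeter n k l, ¬ (Separates H (baseRegion n) (baseRegion n) ∧ incrCoord H = r) := by
      intro H hH h
      have := h.1 b hb b hb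
      nlinarith [mul_self_nonneg (hval H b)]
    simp [pakStanleyLabel, Finset.filter_eq_empty_iff.2 this]
  · intro R₁ h₁ R₂ h₂ H hH huniq hsame r
    have key := separates_step hB h₁ h₂ huniq hsame
    have hnot : ¬ Separates H (baseRegion n) R₁ := (sameSide_iff hB h₁ hH).1 hsame
    unfold pakStanleyLabel
    by_cases hr : r = incrCoord H
    · have : (coxeter n k l).filter (fun H' => Separates H' (baseRegion n) R₂ ∧ incrCoord H' = r) =
          insert H ((coxeter n k l).filter
            (fun H' => Separates H' (baseRegion n) R₁ ∧ incrCoord H' = r)) := by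
        ext H'
        simp only [Finset.mem_filter, Finset.mem_insert]
        constructor
        · rintro ⟨h, h', h''⟩
          rcases (key H' h).1 h' with h3 | h3
          · exact Or.inr ⟨h, h3, h''⟩
          · exact Or.inl h3
        · rintro (h | ⟨h, h', h''⟩)
          · subst h; exact ⟨hH, (key _ hH).2 (Or.inr rfl), hr.symm⟩
          · exact ⟨h, (key _ h).2 (Or.inl h'), h''⟩
      rw [this, Finset.card_insert_of_notMem (by simp [hnot])]
      simp only [hr, if_true]
      omega
    · have : (coxeter n k l).filter (fun H' => Separates H' (baseRegion n) R₂ ∧ incrCoord H' = r) =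
          (coxeter n k l).filter (fun H' => Separates H' (baseRegion n) R₁ ∧ incrCoord H' = r) := by
        refine Finset.filter_congr fun H' h => ?_
        rw [key H' h]
        constructor
        · rintro ⟨h' | h', h''⟩
          · exact ⟨h', h''⟩
          · exact absurd (by rw [← h', h'']) hr
        · rintro ⟨h', h''⟩
          exact ⟨Or.inl h', h''⟩
      rw [this, if_neg hr]
      omega

open Classical in
/-- The hyperplanes of `A` with the points `x`, `y` strictly on opposite sides. -/
noncomputable def sepPts {n : ℕ} (A : Finset (Fin n × Fin n × ℤ)) (x y : Fin n → ℝ) :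
    Finset (Fin n × Fin n × ℤ) :=
  A.filter (fun H => hval H x * hval H y < 0)

theorem mem_sepPts {n : ℕ} {A : Finset (Fin n × Fin n × ℤ)} {x y : Fin n → ℝ}
    {H : Fin n × Fin n × ℤ} : H ∈ sepPts A x y ↔ H ∈ A ∧ hval H x * hval H y < 0 := by
  simp [sepPts]

/-- If a segment crosses `H` before `H'`, some point between the crossings is in a region. -/
theorem exists_between_crossings {n : ℕ} {A : Finset (Fin n × Fin n × ℤ)} {y w : Fin n → ℝ}
    (hy : y ∈ complement A) {H H' : Fin n × Fin n × ℤ}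
    (hH : H ∈ sepPts A y w) (hH' : H' ∈ sepPts A y w)
    (hlt : hval H y / (hval H y - hval H w) < hval H' y / (hval H' y - hval H' w)) :
    ∃ v ∈ complement A, sepPts A y v ⊂ sepPts A y w ∧ (sepPts A y v).Nonempty := by
  classical
  rw [mem_sepPts] at hH hH'
  obtain ⟨t, ht, hbad⟩ := (Set.Ioo_infinite hlt).exists_notMem_finset
    (A.image (fun G => hval G y / (hval G y - hval G w)))
  -- multiplied by the value at `y`, the crossing times are comparisons of products
  have hpos : ∀ G : Fin n × Fin n × ℤ, hval G y * hval G w < 0 →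
      0 < hval G y * (hval G y - hval G w) := by
    intro G hG; nlinarith [mul_self_nonneg (hval G y)]
  have htime : ∀ G : Fin n × Fin n × ℤ, hval G y * hval G w < 0 →
      hval G y / (hval G y - hval G w) * (hval G y * (hval G y - hval G w)) =
        hval G y * hval G y := by
    intro G hG
    have h1 : hval G y - hval G w ≠ 0 := fun h => by
      have := hpos G hG
      rw [h] at this; simp at this
    field_simp
  have p1 := hpos H hH.2
  have p2 := hpos H' hH'.2
  have q1 : hval H y * hval H y < t * (hval H y * (hval H y - hval H w)) := by
    rw [← htime H hH.2]; exact mul_lt_mul_of_pos_right ht.1 p1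
  have q2 : t * (hval H' y * (hval H' y - hval H' w)) < hval H' y * hval H' y := by
    rw [← htime H' hH'.2]; exact mul_lt_mul_of_pos_right ht.2 p2
  have t0 : 0 < t := by
    by_contra h
    have := mul_nonpos_of_nonpos_of_nonneg (not_lt.1 h) p1.le
    nlinarith [mul_self_nonneg (hval H y)]
  have t1 : t < 1 := by
    by_contra h
    have := mul_le_mul_of_nonneg_right (not_lt.1 h) p2.le
    nlinarith
  refine ⟨fun r => (1 - t) * y r + t * w r, ?_, ?_, ⟨H, ?_⟩⟩
  · intro G hG h0
    rw [hval_segment] at h0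
    by_cases hd : hval G y - hval G w = 0
    · have : hval G w = hval G y := by linarith
      rw [this] at h0
      exact hy G hG (by linarith)
    · apply hbad
      refine Finset.mem_image.2 ⟨G, hG, ?_⟩
      rw [div_eq_iff hd]
      linarith
  · rw [Finset.ssubset_iff_of_subset]
    · refine ⟨H', mem_sepPts.2 hH', ?_⟩
      rw [mem_sepPts, hval_segment]
      rintro ⟨-, h⟩
      nlinarith
    · intro G
      rw [mem_sepPts, mem_sepPts, hval_segment]
      rintro ⟨h1, h2⟩
      refine ⟨h1, ?_⟩
      by_contra hcon
      have h3 := mul_nonneg t0.le (not_lt.1 hcon)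
      have h4 := mul_nonneg (sub_pos.2 t1).le (mul_self_nonneg (hval G y))
      nlinarith
  · rw [mem_sepPts, hval_segment]
    exact ⟨hH.1, by nlinarith⟩

/-- The endpoint of a segment can be moved within its region so that two given hyperplanes are
crossed at different times. -/
theorem exists_perturbation {n k l : ℕ} {y w : Fin n → ℝ} (hw : w ∈ complement (coxeter n k l))
    {H H' : Fin n × Fin n × ℤ} (hne : H ≠ H')
    (hH : H ∈ sepPts (coxeter n k l) y w) (hH' : H' ∈ sepPts (coxeter n k l) y w) :
    ∃ v, (∀ G ∈ coxeter n k l, 0 < hval G w * hval G v) ∧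
      hval H y * hval H' v ≠ hval H' y * hval H v := by
  by_cases heq : hval H y * hval H' w = hval H' y * hval H w
  swap
  · exact ⟨w, fun G hG => mul_self_pos.2 (hw G hG), heq⟩
  rw [mem_sepPts] at hH hH'
  have a0 : hval H y ≠ 0 := fun h => by rw [h] at hH; simp at hH
  have a0' : hval H' y ≠ 0 := fun h => by rw [h] at hH'; simp at hH'
  have hl : H.1 < H.2.1 := (Finset.mem_filter.1 hH.1).2
  have hl' : H'.1 < H'.2.1 := (Finset.mem_filter.1 hH'.1).2
  set c : Fin n × Fin n × ℤ → Fin n → ℝ := fun G r =>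
    (if G.1 = r then 1 else 0) - (if G.2.1 = r then 1 else 0) with hc
  have hr : ∃ r, hval H y * c H' r ≠ hval H' y * c H r := by
    by_cases e1 : H.1 = H'.1 ∨ H.1 = H'.2.1
    · by_cases e2 : H.2.1 = H'.1 ∨ H.2.1 = H'.2.1
      · exfalso
        have h1 : H.1 = H'.1 := by
          rcases e1 with h | h
          · exact h
          · rcases e2 with h' | h'
            · rw [h, h'] at hl; exact absurd hl (not_lt.2 hl'.le)
            · rw [h, h'] at hl; exact absurd hl (lt_irrefl _)
        have h2 : H.2.1 = H'.2.1 := by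
          rcases e2 with h | h
          · rw [h1, h] at hl; exact absurd hl (lt_irrefl _)
          · exact h
        have h3 : (H.2.2 : ℝ) ≠ (H'.2.2 : ℝ) := by
          intro h
          apply hne
          exact Prod.ext h1 (Prod.ext h2 (by exact_mod_cast h))
        have h4 := hH.2
        unfold hval at heq h4
        rw [h1, h2] at heq h4
        have h5 : ((H.2.2 : ℝ) - (H'.2.2 : ℝ)) *
            ((y H'.1 - y H'.2.1) - (w H'.1 - w H'.2.1)) = 0 := by linarith
        rcases mul_eq_zero.1 h5 with h | h
        · exact h3 (by linarith)
        · have : y H'.1 - y H'.2.1 = w H'.1 - w H'.2.1 := by linarith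
          rw [this] at h4
          nlinarith [mul_self_nonneg (w H'.1 - w H'.2.1 - (H.2.2 : ℝ))]
      · push Not at e2
        refine ⟨H.2.1, ?_⟩
        simp only [hc, if_neg e2.1.symm, if_neg e2.2.symm, if_neg hl.ne, if_true]
        intro h
        exact a0' (by linarith)
    · push Not at e1
      refine ⟨H.1, ?_⟩
      simp only [hc, if_neg e1.1.symm, if_neg e1.2.symm, if_neg hl.ne', if_true]
      intro h
      exact a0' (by linarith)
  obtain ⟨r, hr⟩ := hr
  have hmove : ∀ (G : Fin n × Fin n × ℤ) (δ : ℝ),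
      hval G (w + δ • fun s => if s = r then 1 else 0) = hval G w + δ * c G r := by
    intro G δ
    simp only [hval, hc, Pi.add_apply, Pi.smul_apply, smul_eq_mul]
    ring
  have hev : ∀ᶠ δ in nhdsWithin (0 : ℝ) (Set.Ioi 0), ∀ G ∈ coxeter n k l,
      0 < hval G w * (hval G w + δ * c G r) := by
    rw [Filter.eventually_all_finset]
    intro G hG
    refine Filter.Eventually.filter_mono nhdsWithin_le_nhds ?_
    have hcont : Continuous (fun δ : ℝ => hval G w * (hval G w + δ * c G r)) := by fun_prop
    refine hcont.continuousAt.eventually (lt_mem_nhds ?_)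
    simpa using mul_self_pos.2 (hw G hG)
  obtain ⟨δ, hδ, hδ0⟩ := (hev.and self_mem_nhdsWithin).exists
  refine ⟨w + δ • fun s => if s = r then 1 else 0, ?_, ?_⟩
  · intro G hG
    rw [hmove]
    exact hδ G hG
  · rw [hmove, hmove]
    intro h
    have h1 : δ * (hval H y * c H' r - hval H' y * c H r) = 0 := by linarith
    rcases mul_eq_zero.1 h1 with h2 | h2
    · exact (ne_of_gt hδ0) h2
    · exact hr (by linarith)

/-- Every region other than `B` has a neighbour from which it is reached by crossing one hyperplane
away from `B`. -/
theorem exists_neighbour {n k l : ℕ} {B R : Set (Fin n → ℝ)} (hB : B ∈ regions (coxeter n k l))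
    (hR : R ∈ regions (coxeter n k l)) (hne : R ≠ B) :
    ∃ R₁ ∈ regions (coxeter n k l), ∃ H ∈ coxeter n k l,
      (∀ H' ∈ coxeter n k l, Separates H' R₁ R ↔ H' = H) ∧ SameSide H B R₁ := by
  classical
  obtain ⟨b, hb⟩ := region_nonempty hB
  obtain ⟨y, hy⟩ := region_nonempty hR
  have hbc := hval_ne_zero_of_mem hB hb
  have hyc := hval_ne_zero_of_mem hR hy
  have hS : ({w | w ∈ complement (coxeter n k l) ∧ (sepPts (coxeter n k l) y w).Nonempty ∧
      sepPts (coxeter n k l) y w ⊆ sepPts (coxeter n k l) y b} : Set (Fin n → ℝ)).Nonempty := by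
    refine ⟨b, hbc, ?_, Finset.Subset.refl _⟩
    by_contra hemp
    rw [Finset.not_nonempty_iff_eq_empty] at hemp
    apply hne
    have : b ∈ connectedComponentIn (complement (coxeter n k l)) y := by
      rw [mem_component_iff hyc]
      intro H hH
      have h1 : H ∉ sepPts (coxeter n k l) y b := by simp [hemp]
      rw [mem_sepPts] at h1
      push Not at h1
      exact lt_of_le_of_ne (h1 hH) (mul_ne_zero (hyc H hH) (hbc H hH)).symm
    rw [eq_component hR hy, eq_component hB hb]
    exact connectedComponentIn_eq this
  obtain ⟨w, ⟨hwc, hwne, hwsub⟩, hmin⟩ :=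
    (measure (fun w => (sepPts (coxeter n k l) y w).card)).wf.has_min _ hS
  have hmin' : ∀ v ∈ complement (coxeter n k l), (sepPts (coxeter n k l) y v).Nonempty →
      ¬ sepPts (coxeter n k l) y v ⊂ sepPts (coxeter n k l) y w := by
    intro v hv hvne hss
    exact hmin v ⟨hv, hvne, hss.1.trans hwsub⟩ (Finset.card_lt_card hss)
  obtain ⟨H, hHw⟩ := hwne
  have hone : ∀ H' ∈ sepPts (coxeter n k l) y w, H' = H := by
    intro H' hH'w
    by_contra hd
    obtain ⟨v, hv, hvt⟩ := exists_perturbation hwc (Ne.symm hd) hHw hH'w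
    have hsep : sepPts (coxeter n k l) y v = sepPts (coxeter n k l) y w := by
      ext G
      rw [mem_sepPts, mem_sepPts]
      refine and_congr_right fun hG => ?_
      have := hv G hG
      rw [mul_pos_iff] at this
      rw [mul_neg_iff, mul_neg_iff]
      rcases this with ⟨h1, h2⟩ | ⟨h1, h2⟩
      · simp [h1, h2, not_lt.2 h1.le, not_lt.2 h2.le]
      · simp [h1, h2, not_lt.2 h1.le, not_lt.2 h2.le]
    have m1 : H ∈ sepPts (coxeter n k l) y v := hsep ▸ hHw
    have m2 : H' ∈ sepPts (coxeter n k l) y v := hsep ▸ hH'w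
    have d : ∀ G ∈ sepPts (coxeter n k l) y v, hval G y - hval G v ≠ 0 := by
      intro G hG h0
      have h1 := (mem_sepPts.1 hG).2
      have h2 : hval G v = hval G y := by linarith
      rw [h2] at h1
      nlinarith [mul_self_nonneg (hval G y)]
    rcases lt_trichotomy (hval H y / (hval H y - hval H v))
        (hval H' y / (hval H' y - hval H' v)) with h | h | h
    · obtain ⟨u, hu, hu1, hu2⟩ := exists_between_crossings hyc m1 m2 h
      exact hmin' u hu hu2 (hsep ▸ hu1)
    · rw [div_eq_div_iff (d H m1) (d H' m2)] at h
      exact hvt (by linarith)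
    · obtain ⟨u, hu, hu1, hu2⟩ := exists_between_crossings hyc m2 m1 h
      exact hmin' u hu hu2 (hsep ▸ hu1)
  have hW : connectedComponentIn (complement (coxeter n k l)) w ∈ regions (coxeter n k l) :=
    ⟨w, hwc, rfl⟩
  have hww := mem_connectedComponentIn hwc
  have hHA := (mem_sepPts.1 hHw).1
  refine ⟨_, hW, H, hHA, ?_, ?_⟩
  · intro H' hH'
    rw [separates_iff hW hR hH' hww hy, mul_comm]
    constructor
    · intro h; exact hone H' (mem_sepPts.2 ⟨hH', h⟩)
    · intro h; rw [h]; exact (mem_sepPts.1 hHw).2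
  · rw [sameSide_iff hB hW hHA, separates_iff hB hW hHA hb hww]
    have h1 := (mem_sepPts.1 hHw).2
    have h2 := (mem_sepPts.1 (hwsub hHw)).2
    rw [mul_neg_iff] at h1 h2 ⊢
    rintro (h3 | h3) <;> rcases h1 with h1 | h1 <;> rcases h2 with h2 | h2 <;>
      linarith [h1.1, h1.2, h2.1, h2.2, h3.1, h3.2]

/-- Any labeling obeying the defining rules agrees with `pakStanleyLabel` on the regions. -/
theorem IsPakStanleyLabeling.unique {n k l : ℕ} (hk : 0 < k)
    {lab : Set (Fin n → ℝ) → Fin n → ℕ} (h : IsPakStanleyLabeling (coxeter n k l) lab)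
    {R : Set (Fin n → ℝ)} (hR : R ∈ regions (coxeter n k l)) :
    lab R = pakStanleyLabel (coxeter n k l) R := by
  classical
  have hB : baseRegion n ∈ regions (coxeter n k l) := baseRegion_mem_regions hk
  have h' := isPakStanleyLabeling (n := n) (l := l) hk
  have main : ∀ N : ℕ, ∀ R ∈ regions (coxeter n k l),
      ((coxeter n k l).filter (fun H => Separates H (baseRegion n) R)).card = N →
        lab R = pakStanleyLabel (coxeter n k l) R := by
    intro N
    induction N using Nat.strong_induction_on with
    | _ N ih =>
      intro R hR hN
      by_cases hRB : R = baseRegion n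
      · subst hRB
        funext r
        rw [h.base, h'.base]
      · obtain ⟨R₁, h₁, H, hH, huniq, hsame⟩ := exists_neighbour hB hR hRB
        have key := separates_step hB h₁ hR huniq hsame
        have hlt : ((coxeter n k l).filter (fun H => Separates H (baseRegion n) R₁)).card < N := by
          rw [← hN]
          apply Finset.card_lt_card
          rw [Finset.ssubset_iff_of_subset]
          · refine ⟨H, by simp [hH, (key H hH).2 (Or.inr rfl)], ?_⟩
            simp [hH, (sameSide_iff hB h₁ hH).1 hsame]
          · intro G hG
            rw [Finset.mem_filter] at hG ⊢
            exact ⟨hG.1, (key G hG.1).2 (Or.inl hG.2)⟩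
        have hI := ih _ hlt R₁ h₁ rfl
        funext r
        rw [h.step R₁ h₁ R hR H hH huniq hsame, h'.step R₁ h₁ R hR H hH huniq hsame, hI]
  exact main _ R hR rfl

end MCatalan

namespace MCatalan

/-! Crossing `x i - x j = a` away from `R₀` increases the coordinate whose index carries the smaller
side of the comparison. Hence the label of the region of `x` has `r`-th coordinate `1` plus the
number of shifted points `x k - b`, `1 ≤ b ≤ m`, lying above `x r`, plus the number of `k > r` with
`x k > x r` (`pakStanleyLabel_component`). Relative boundedness of the region also becomes a
condition on `x`: consecutive coordinates, in order of size, differ by less than `m` (`GapsLT`).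

Labels are prime: let `T` be the set of the `i` largest coordinates. Above `x r`, `r ∈ T`, there are
only shifts of the other `i - 1` elements of `T`, so at most `(i-1)m` of them. If the gaps are less
than `m` and `i ≥ 2`, at least one shift by `m` is missing. The term counting `k > r` is absorbed by
the rank of `r` inside `T`, so `T` satisfies the condition defining the center.

Prime functions are labels: the coordinates are placed greedily from the largest down. Given the
placed set `T`, each remaining `s` still requires `a s - 1 - #{k ∈ T | k > s}` shifts above it. The
next element is one with the smallest requirement `N` and, among those, the smallest index; it is
put below `T` with exactly `N` shifts above it. Primality gives `N < |T| m` for nonempty `T`, which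
forces the new gap to be less than `m`; the choice of `s` ensures that no remaining requirement is
overshot (`IsPartialPlacement.exists_insert`). Lower points do not affect the labels of higher ones,
so the final placement has label `a`. Neither counting of regions nor injectivity of the labeling is
involved. -/

open Finset in
/-- A finite family of distinct reals has any prescribed number of members above some real `y`,
which can be chosen outside a countable set. -/
theorem exists_card_filter_lt_eq {ι : Type*} (S : Finset ι) {f : ι → ℝ} (hf : Set.InjOn f S)
    {B : Set ℝ} (hB : B.Countable) (K : ℕ) (hK : K ≤ S.card) :
    ∃ y ∉ B, (S.filter (fun q => y < f q)).card = K := by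
  classical
  have hdense := hB.dense_compl ℝ
  induction K with
  | zero =>
    obtain ⟨M, hM⟩ := (S.image f).exists_le
    obtain ⟨y, hy, hMy, -⟩ := hdense.exists_between (show M < M + 1 by linarith)
    refine ⟨y, hy, ?_⟩
    rw [card_eq_zero, filter_eq_empty_iff]
    intro q hq
    have := hM _ (mem_image_of_mem f hq)
    linarith
  | succ K ih =>
    obtain ⟨y, -, hcard⟩ := ih (by omega)
    have hne : (S.filter (fun q => ¬ y < f q)).Nonempty := by
      rw [← card_pos]
      have := card_filter_add_card_filter_not (s := S) (fun q => y < f q)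
      omega
    -- The threshold is lowered past exactly one more value: `f p` is the highest value not yet
    -- above it, and `l` bounds all values below `f p`, so a threshold strictly between `l` and `f
    -- p` adds only `p`.
    obtain ⟨p, hp, hmax⟩ := exists_max_image _ f hne
    rw [mem_filter, not_lt] at hp
    obtain ⟨l, hl, hlt⟩ : ∃ l < f p, ∀ q ∈ S, f q < f p → f q ≤ l := by
      by_cases hS : (S.filter (fun q => f q < f p)).Nonempty
      · obtain ⟨t, ht, htmax⟩ := exists_max_image _ f hS
        exact ⟨f t, (mem_filter.1 ht).2, fun q hq h => htmax q (mem_filter.2 ⟨hq, h⟩)⟩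
      · exact ⟨f p - 1, by linarith, fun q hq h => (hS ⟨q, mem_filter.2 ⟨hq, h⟩⟩).elim⟩
    obtain ⟨z, hz, hlz, hzp⟩ := hdense.exists_between hl
    refine ⟨z, hz, ?_⟩
    have : S.filter (fun q => z < f q) = insert p (S.filter (fun q => y < f q)) := by
      ext q
      simp only [mem_filter, mem_insert]
      constructor
      · rintro ⟨hq, h⟩
        by_cases hyq : y < f q
        · exact Or.inr ⟨hq, hyq⟩
        · left
          have h1 := hmax q (mem_filter.2 ⟨hq, hyq⟩)
          rcases h1.lt_or_eq with h2 | h2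
          · linarith [hlt q hq h2]
          · exact hf hq hp.1 h2
      · rintro (rfl | ⟨hq, h⟩)
        · exact ⟨hp.1, hzp⟩
        · exact ⟨hq, by linarith [hp.2]⟩
    rw [this, card_insert_of_notMem (by simp [hp.2]), hcard]

/-! ### A formula for the label -/

/-- The pairs `(k, b)` with `k ∈ T`, `1 ≤ b ≤ m` and `y < x k - b`. -/
noncomputable def shiftsAbove {n : ℕ} (m : ℕ) (T : Finset (Fin n)) (x : Fin n → ℝ) (y : ℝ) :
    Finset (Fin n × ℤ) :=
  (T ×ˢ Finset.Icc (1 : ℤ) m).filter (fun q => y < x q.1 - q.2)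

theorem mem_shiftsAbove {n m : ℕ} {T : Finset (Fin n)} {x : Fin n → ℝ} {y : ℝ} {q : Fin n × ℤ} :
    q ∈ shiftsAbove m T x y ↔ q.1 ∈ T ∧ 1 ≤ q.2 ∧ q.2 ≤ m ∧ y < x q.1 - q.2 := by
  simp [shiftsAbove, and_assoc]

theorem mem_catalan {n m : ℕ} {H : Fin n × Fin n × ℤ} :
    H ∈ catalan n m ↔ H.1 < H.2.1 ∧ -(m : ℤ) ≤ H.2.2 ∧ H.2.2 ≤ m := by
  simp only [catalan, coxeter, Finset.mem_filter, Finset.mem_product, Finset.mem_univ,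
    Finset.mem_Icc, true_and]
  tauto

/-- The range `[-m, m]` is symmetric, so the restriction `i < j` can be dropped; later arguments
then need not compare indices. -/
theorem mem_complement_catalan {n m : ℕ} {x : Fin n → ℝ} :
    x ∈ complement (catalan n m) ↔
      ∀ k l, k ≠ l → ∀ c : ℤ, -(m : ℤ) ≤ c → c ≤ m → x k - x l ≠ c := by
  constructor
  · intro h k l hkl c h1 h2 he
    rcases lt_or_gt_of_ne hkl with hlt | hlt
    · refine h (k, l, c) (mem_catalan.2 ⟨hlt, h1, h2⟩) ?_
      simp only [hval]; linarith
    · refine h (l, k, -c) (mem_catalan.2 ⟨hlt, by simpa using h2, by simp; omega⟩) ?_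
      simp only [hval]; push_cast; linarith
  · intro h H hH h0
    obtain ⟨hlt, h1, h2⟩ := mem_catalan.1 hH
    refine h _ _ hlt.ne _ h1 h2 ?_
    simp only [hval] at h0; linarith

/-- On `R₀` every difference `x i - x j` with `i < j` lies in `(0, 1)`, hence below `a` when `a > 0`
and above `a` when `a ≤ 0`. -/
theorem separates_baseRegion_iff {n m : ℕ} (hm : 0 < m) {x : Fin n → ℝ}
    (hx : x ∈ complement (catalan n m)) {H : Fin n × Fin n × ℤ} (hH : H ∈ catalan n m) :
    Separates H (baseRegion n) (connectedComponentIn (complement (catalan n m)) x) ↔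
      (0 < H.2.2 ∧ (H.2.2 : ℝ) < x H.1 - x H.2.1) ∨
        (H.2.2 ≤ 0 ∧ x H.1 - x H.2.1 < (H.2.2 : ℝ)) := by
  obtain ⟨b, hb⟩ := baseRegion_nonempty n
  have hB : baseRegion n ∈ regions (catalan n m) := baseRegion_mem_regions hm
  rw [separates_iff hB ⟨x, hx, rfl⟩ hH hb (mem_connectedComponentIn hx)]
  rcases baseRegion_side hH hb with h | h
  · rw [mul_neg_iff]
    simp only [h.2, not_lt.2 h.2.le, h.1, not_le.2 h.1, false_and, true_and, or_false, false_or]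
    simp only [hval, sub_pos]
  · rw [mul_neg_iff]
    simp only [h.2, not_lt.2 h.2.le, h.1, not_lt.2 h.1, false_and, true_and, or_false, false_or]
    simp only [hval, sub_neg]

-- A separating hyperplane that increases `r` says that `x r < x k - |a|`, where `k` is its other
-- index: `k < r` if `a > 0`, and `k > r` if `a ≤ 0`. For `a ≠ 0` the sign of `a` and the position
-- of `k` determine each other, so all pairs `(k, |a|)` occur; for `a = 0` only `k > r` remains.
open Finset in
theorem pakStanleyLabel_component {n m : ℕ} (hm : 0 < m) {x : Fin n → ℝ}
    (hx : x ∈ complement (catalan n m)) (r : Fin n) :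
    pakStanleyLabel (catalan n m) (connectedComponentIn (complement (catalan n m)) x) r =
      1 + (shiftsAbove m univ x (x r)).card +
        (univ.filter (fun k => r < k ∧ x r < x k)).card := by
  classical
  have hfilter : (catalan n m).filter (fun H => Separates H (baseRegion n)
      (connectedComponentIn (complement (catalan n m)) x) ∧ incrCoord H = r) =
      (catalan n m).filter (fun H => (0 < H.2.2 ∧ (H.2.2 : ℝ) < x H.1 - x H.2.1 ∧ H.2.1 = r) ∨
        (H.2.2 ≤ 0 ∧ x H.1 - x H.2.1 < (H.2.2 : ℝ) ∧ H.1 = r)) := by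
    refine filter_congr fun H hH => ?_
    rw [separates_baseRegion_iff hm hx hH, incrCoord]
    rcases lt_or_ge 0 H.2.2 with h | h
    · simp [h, not_le.2 h]
    · simp [h, not_lt.2 h]
  unfold pakStanleyLabel
  rw [add_assoc]
  congr 1
  have hcongr : ∀ s t : Finset (Fin n × Fin n × ℤ), s = t → s.card = t.card := by
    rintro s t rfl; rfl
  refine (hcongr _ _ (by convert hfilter)).trans ?_
  rw [← card_filter_add_card_filter_not (fun H : Fin n × Fin n × ℤ => H.2.2 ≠ 0)]
  congr 1
  · refine card_nbij' (fun H => if 0 < H.2.2 then (H.1, H.2.2) else (H.2.1, -H.2.2))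
      (fun q => if q.1 < r then (q.1, r, q.2) else (r, q.1, -q.2)) ?_ ?_ ?_ ?_
    · rintro ⟨i, j, c⟩ h
      simp only [coe_filter, mem_filter, Set.mem_ofPred_eq, mem_catalan] at h
      obtain ⟨⟨⟨hij, h1, h2⟩, h3 | h3⟩, h0⟩ := h
      · obtain ⟨h3, h4, rfl⟩ := h3
        simp only [h3, if_true, mem_coe, mem_shiftsAbove, mem_univ, true_and]
        exact ⟨h3, h2, by linarith⟩
      · obtain ⟨h3, h4, rfl⟩ := h3
        simp only [not_lt.2 h3, if_false, mem_coe, mem_shiftsAbove, mem_univ, true_and]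
        refine ⟨by omega, by omega, ?_⟩
        push_cast; linarith
    · rintro ⟨k, b⟩ h
      simp only [mem_coe, mem_shiftsAbove, mem_univ, true_and] at h
      obtain ⟨h1, h2, h3⟩ := h
      have hb : (1 : ℝ) ≤ (b : ℝ) := by exact_mod_cast h1
      have hk : k ≠ r := by rintro rfl; linarith
      simp only [coe_filter, mem_filter, Set.mem_ofPred_eq, mem_catalan]
      rcases lt_or_gt_of_ne hk with hlt | hlt
      · simp only [hlt, if_true]
        exact ⟨⟨⟨trivial, by omega, h2⟩, Or.inl ⟨by omega, by linarith, trivial⟩⟩, by omega⟩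
      · simp only [not_lt.2 hlt.le, if_false]
        refine ⟨⟨⟨hlt, by omega, by omega⟩, Or.inr ⟨by omega, ?_, trivial⟩⟩, by omega⟩
        push_cast; linarith
    · rintro ⟨i, j, c⟩ h
      simp only [coe_filter, mem_filter, Set.mem_ofPred_eq, mem_catalan] at h
      obtain ⟨⟨⟨hij, h1, h2⟩, h3 | h3⟩, h0⟩ := h
      · obtain ⟨h3, h4, rfl⟩ := h3
        simp [h3, hij]
      · obtain ⟨h3, h4, rfl⟩ := h3
        simp [not_lt.2 h3, not_lt.2 hij.le]
    · rintro ⟨k, b⟩ h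
      simp only [mem_coe, mem_shiftsAbove, mem_univ, true_and] at h
      obtain ⟨h1, h2, h3⟩ := h
      have hb0 : 0 < b := by omega
      by_cases hk : k < r
      · simp [hk, hb0]
      · simp [hk, not_lt.2 hb0.le]
  · refine card_nbij' (fun H => H.2.1) (fun k => (r, k, 0)) ?_ ?_ ?_ ?_
    · rintro ⟨i, j, c⟩ h
      simp only [coe_filter, mem_filter, Set.mem_ofPred_eq, mem_catalan, not_not] at h
      obtain ⟨⟨⟨hij, h1, h2⟩, h3⟩, rfl⟩ := h
      rcases h3 with h3 | ⟨-, h4, rfl⟩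
      · exact absurd h3.1 (lt_irrefl _)
      · rw [Int.cast_zero] at h4
        simp only [coe_filter, mem_univ, true_and, Set.mem_ofPred_eq]
        exact ⟨hij, by linarith⟩
    · intro k h
      simp only [coe_filter, mem_univ, true_and, Set.mem_ofPred_eq] at h
      simp only [coe_filter, mem_filter, Set.mem_ofPred_eq, mem_catalan, not_not]
      exact ⟨⟨⟨h.1, by omega, by omega⟩, Or.inr ⟨le_rfl, by rw [Int.cast_zero]; linarith, trivial⟩⟩,
        trivial⟩
    · rintro ⟨i, j, c⟩ h
      simp only [coe_filter, mem_filter, Set.mem_ofPred_eq, mem_catalan, not_not] at h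
      obtain ⟨⟨⟨hij, h1, h2⟩, h3⟩, rfl⟩ := h
      rcases h3 with h3 | ⟨-, h4, rfl⟩
      · exact absurd h3.1 (lt_irrefl _)
      · rfl
    · intro k _
      rfl

/-! ### Relatively bounded regions -/

/-- Every coordinate of `x` which is not maximal is less than `m` below some larger coordinate. -/
def GapsLT {n : ℕ} (m : ℕ) (x : Fin n → ℝ) : Prop :=
  ∀ r, (∃ k, x r < x k) → ∃ k, x r < x k ∧ x k < x r + m

theorem mem_component_catalan_iff {n m : ℕ} {x : Fin n → ℝ}
    (hx : x ∈ complement (catalan n m)) (y : Fin n → ℝ) :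
    y ∈ connectedComponentIn (complement (catalan n m)) x ↔
      ∀ k l, k ≠ l → ∀ c : ℤ, -(m : ℤ) ≤ c → c ≤ m →
        0 < (x k - x l - c) * (y k - y l - c) := by
  rw [mem_component_iff hx]
  constructor
  · intro h k l hkl c h1 h2
    rcases lt_or_gt_of_ne hkl with hlt | hlt
    · exact h (k, l, c) (mem_catalan.2 ⟨hlt, h1, h2⟩)
    · have := h (l, k, -c) (mem_catalan.2 ⟨hlt, by simpa using h2, by simp; omega⟩)
      simp only [hval] at this
      push_cast at this
      linarith
  · intro h H hH
    obtain ⟨hlt, h1, h2⟩ := mem_catalan.1 hH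
    exact h _ _ hlt.ne _ h1 h2

/-- Across a gap of at least `m`, every difference already exceeds all constants of the arrangement
in absolute value, so the coordinates above the gap can be raised arbitrarily far without leaving
the region. -/
theorem gapsLT_of_isRelativelyBounded {n m : ℕ} {x : Fin n → ℝ}
    (hx : x ∈ complement (catalan n m))
    (hR : IsRelativelyBounded (connectedComponentIn (complement (catalan n m)) x)) :
    GapsLT m x := by
  classical
  rintro r ⟨k, hk⟩
  by_contra! hgap
  have hn : (n : ℝ) ≠ 0 := by
    have := r.pos
    positivity
  obtain ⟨C, hC⟩ := hR.exists_norm_le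
  set v : ℝ → Fin n → ℝ := fun t i => x i + (if x r < x i then t else 0) with hv
  -- Subtracting the mean moves the point to the hyperplane of coordinate sum `0` and preserves all
  -- differences, hence the region.
  set w : ℝ → Fin n → ℝ := fun t i => v t i - (∑ j, v t j) / n with hw
  have hdiff : ∀ t i j, w t i - w t j = v t i - v t j := by
    intro t i j; simp only [hw]; ring
  have hsum : ∀ t, ∑ i, w t i = 0 := by
    intro t
    simp only [hw, Finset.sum_sub_distrib, Finset.sum_const, Finset.card_univ, Fintype.card_fin,
      nsmul_eq_mul]
    field_simp
    ring
  have hmem : ∀ t, 0 ≤ t → w t ∈ connectedComponentIn (complement (catalan n m)) x := by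
    intro t ht
    rw [mem_component_catalan_iff hx]
    intro i j hij c h1 h2
    rw [hdiff]
    have hne : x i - x j - c ≠ 0 := sub_ne_zero.2 (mem_complement_catalan.1 hx i j hij c h1 h2)
    have h1' : -(m : ℝ) ≤ c := by exact_mod_cast h1
    have h2' : (c : ℝ) ≤ m := by exact_mod_cast h2
    have hpos := mul_self_pos.2 hne
    simp only [hv]
    by_cases hi : x r < x i <;> by_cases hj : x r < x j
    · simp only [hi, hj, if_true]
      rwa [add_sub_add_right_eq_sub]
    · simp only [hi, hj, if_true, if_false]
      have h3 := hgap i hi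
      have h4 : 0 < x i - x j - c := lt_of_le_of_ne (by linarith) hne.symm
      exact mul_pos h4 (by linarith)
    · simp only [hi, hj, if_true, if_false]
      have h3 := hgap j hj
      have h4 : x i - x j - c < 0 := lt_of_le_of_ne (by linarith) hne
      exact mul_pos_of_neg_of_neg h4 (by linarith)
    · simp only [hi, hj, if_false]
      rwa [add_sub_add_right_eq_sub]
  have hbd : ∀ t, 0 ≤ t → x k - x r + t ≤ 2 * C := by
    intro t ht
    have h1 := hC (w t) ⟨hmem t ht, hsum t⟩
    have h2 := (Real.norm_eq_abs _ ▸ norm_le_pi_norm (w t) k).trans h1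
    have h3 := (Real.norm_eq_abs _ ▸ norm_le_pi_norm (w t) r).trans h1
    have h4 : w t k - w t r = x k - x r + t := by
      rw [hdiff]; simp only [hv, hk, lt_irrefl, if_true, if_false]; ring
    rw [abs_le] at h2 h3
    linarith [h2.2, h3.1]
  have h0 := hbd 0 le_rfl
  -- Taking `t = 2 * C` leaves `x k - x r ≤ 0`, contrary to `hk`.
  have := hbd (2 * C) (by linarith)
  linarith

/-- The order of the coordinates and the inequalities `x k < x r + m` persist, weakly, throughout
the region. Climbing from any coordinate to a maximal one in steps of at most `m` bounds all
differences, and the sum condition then bounds the coordinates themselves. -/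
theorem isRelativelyBounded_of_gapsLT {n m : ℕ} {x : Fin n → ℝ}
    (hx : x ∈ complement (catalan n m)) (hgap : GapsLT m x) :
    IsRelativelyBounded (connectedComponentIn (complement (catalan n m)) x) := by
  classical
  rw [IsRelativelyBounded, isBounded_iff_forall_norm_le]
  refine ⟨m * n, ?_⟩
  rintro y ⟨hy, hsum⟩
  rw [mem_component_catalan_iff hx] at hy
  have horder : ∀ k l, x k ≤ x l → y k ≤ y l := by
    intro k l hkl
    rcases eq_or_ne k l with rfl | hne
    · exact le_rfl
    · have := hy k l hne 0 (by omega) (by omega)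
      simp only [Int.cast_zero, sub_zero] at this
      by_contra! hcon
      nlinarith
  have hclose : ∀ k l, x k < x l + m → y k ≤ y l + m := by
    intro k l hkl
    rcases eq_or_ne k l with rfl | hne
    · simp
    · have := hy k l hne m (by omega) (by omega)
      simp only [Int.cast_natCast] at this
      by_contra! hcon
      nlinarith
  -- Each step of the climb strictly decreases the number `N` of larger coordinates, so at most `N`
  -- steps are needed.
  have hrank : ∀ N : ℕ, ∀ r, (Finset.univ.filter (fun k => x r < x k)).card = N →
      ∀ l, y l - y r ≤ m * N := by
    intro N
    induction N using Nat.strong_induction_on with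
    | _ N ih =>
      intro r hr l
      by_cases htop : ∃ k, x r < x k
      · obtain ⟨k, hk, hkm⟩ := hgap r htop
        have hlt : (Finset.univ.filter (fun j => x k < x j)).card < N := by
          rw [← hr]
          refine Finset.card_lt_card (Finset.ssubset_iff_of_subset ?_ |>.2 ⟨k, by simpa, by simp⟩)
          intro j hj
          simp only [Finset.mem_filter, Finset.mem_univ, true_and] at hj ⊢
          exact hk.trans hj
        have h1 := ih _ hlt k rfl l
        have h2 := hclose k r hkm
        have h3 : ((Finset.univ.filter (fun j => x k < x j)).card : ℝ) + 1 ≤ N := by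
          exact_mod_cast hlt
        have h4 := mul_le_mul_of_nonneg_left h3 (Nat.cast_nonneg (α := ℝ) m)
        linarith
      · push Not at htop
        have := horder l r (htop l)
        have : (0 : ℝ) ≤ m * N := by positivity
        linarith
  have hdiff : ∀ r l, y l - y r ≤ m * n := by
    intro r l
    refine (hrank _ r rfl l).trans ?_
    gcongr
    exact_mod_cast (Finset.card_le_univ _).trans (Fintype.card_fin n).le
  rw [pi_norm_le_iff_of_nonneg (by positivity)]
  intro r
  have hn : (0 : ℝ) < n := by exact_mod_cast r.pos
  have hsum' : ∑ l, y l = 0 := hsum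
  -- As the coordinates sum to `0`, `y r` is the average of the differences `y r - y l`.
  have e1 : ∑ l, (y l - y r) = -(n * y r) := by
    simp [Finset.sum_sub_distrib, hsum']
  have e2 : ∑ l, (y r - y l) = n * y r := by
    simp [Finset.sum_sub_distrib, hsum']
  have b1 : ∑ l, (y l - y r) ≤ ∑ _l : Fin n, (m * n : ℝ) := Finset.sum_le_sum fun l _ => hdiff r l
  have b2 : ∑ l, (y r - y l) ≤ ∑ _l : Fin n, (m * n : ℝ) := Finset.sum_le_sum fun l _ => hdiff l r
  simp only [Finset.sum_const, Finset.card_univ, Fintype.card_fin, nsmul_eq_mul] at b1 b2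
  rw [Real.norm_eq_abs, abs_le]
  constructor
  · refine le_of_mul_le_mul_left ?_ hn
    linarith
  · refine le_of_mul_le_mul_left ?_ hn
    linarith

/-! ### Labels of relatively bounded regions are prime -/

/-- If at most `N` shifts of elements of `T` are counted in each coordinate `r ∈ T` of `a`, then
`T` satisfies the condition defining the center. -/
theorem card_le_centerCard {n m : ℕ} {a : Fin n → ℕ} {x : Fin n → ℝ} {p : ℤ} {T : Finset (Fin n)}
    (ha : ∀ r, a r = 1 + (shiftsAbove m Finset.univ x (x r)).card +
      (Finset.univ.filter (fun k => r < k ∧ x r < x k)).card)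
    (hT : ∀ r ∈ T, ∀ k, x r < x k → k ∈ T)
    (hp : ∀ r ∈ T, ((shiftsAbove m Finset.univ x (x r)).card : ℤ) ≤ p) :
    T.card ≤ centerCard p a := by
  classical
  refine Finset.card_le_card ((isGreatest_center p a).2 ?_)
  intro r hr
  have h1 : (Finset.univ.filter (fun k => r < k ∧ x r < x k)).card + 1 ≤
      (T.filter (fun k => r ≤ k)).card := by
    rw [Nat.add_one_le_iff]
    refine Finset.card_lt_card (Finset.ssubset_iff_of_subset ?_ |>.2 ⟨r, by simp [hr], by simp⟩)
    intro k hk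
    simp only [Finset.mem_filter, Finset.mem_univ, true_and] at hk ⊢
    exact ⟨hT r hr k hk.2, hk.1.le⟩
  have h2 := hp r hr
  have h3 := ha r
  omega

/-- The top `i` coordinates witness the `i`-th condition. The Catalan bound counts all possible
shifts of the other `i - 1`; the gap condition improves it by one. -/
theorem isPrimeCatalanFunction_of_gapsLT {n m : ℕ} (hm : 0 < m) {x : Fin n → ℝ}
    {a : Fin n → ℕ} (hx : Function.Injective x) (hgap : GapsLT m x)
    (ha : ∀ r, a r = 1 + (shiftsAbove m Finset.univ x (x r)).card +
      (Finset.univ.filter (fun k => r < k ∧ x r < x k)).card) :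
    IsPrimeCatalanFunction m a := by
  classical
  have htop : ∀ i ≤ n, ∃ T : Finset (Fin n), T.card = i ∧ ∀ r ∈ T, ∀ k, x r < x k → k ∈ T := by
    intro i hi
    obtain ⟨y, -, hy⟩ := exists_card_filter_lt_eq Finset.univ hx.injOn Set.countable_empty i
      (by simpa using hi)
    refine ⟨_, hy, fun r hr k hk => ?_⟩
    simp only [Finset.mem_filter, Finset.mem_univ, true_and] at hr ⊢
    exact hr.trans hk
  have hsub : ∀ T : Finset (Fin n), (∀ r ∈ T, ∀ k, x r < x k → k ∈ T) → ∀ r ∈ T,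
      shiftsAbove m Finset.univ x (x r) ⊆ T.erase r ×ˢ Finset.Icc (1 : ℤ) m := by
    intro T hT r hr q hq
    obtain ⟨-, h1, h2, h3⟩ := mem_shiftsAbove.1 hq
    have h1' : (1 : ℝ) ≤ (q.2 : ℝ) := by exact_mod_cast h1
    have h4 : x r < x q.1 := by linarith
    simp only [Finset.mem_product, Finset.mem_erase, Finset.mem_Icc]
    exact ⟨⟨fun h => by rw [h] at h4; exact lt_irrefl _ h4, hT r hr _ h4⟩, h1, h2⟩
  have hcard : ∀ (T : Finset (Fin n)) (r : Fin n), r ∈ T →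
      ((T.erase r ×ˢ Finset.Icc (1 : ℤ) m).card : ℤ) = ((T.card : ℤ) - 1) * m := by
    intro T r hr
    have := Finset.card_erase_add_one hr
    rw [Finset.card_product, Int.card_Icc]
    push_cast
    rw [← this]
    push_cast
    simp
  refine ⟨⟨fun r => by rw [ha r]; omega, fun i _ hi => ?_⟩, fun i hi2 hi => ?_⟩
  · obtain ⟨T, rfl, hT⟩ := htop i hi
    refine card_le_centerCard ha hT fun r hr => ?_
    rw [← hcard T r hr]
    exact_mod_cast Finset.card_le_card (hsub T hT r hr)
  · obtain ⟨T, rfl, hT⟩ := htop i hi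
    refine card_le_centerCard ha hT fun r hr => ?_
    rw [← hcard T r hr, Int.le_sub_one_iff]
    -- For such a `k` the pair `(k, m)` is not counted. When `x r` is maximal, any other element of
    -- `T` serves, which is where `i ≥ 2` enters.
    obtain ⟨k, hk, hkr, hkm⟩ : ∃ k ∈ T, k ≠ r ∧ x k < x r + m := by
      by_cases h : ∃ k, x r < x k
      · obtain ⟨k, h1, h2⟩ := hgap r h
        exact ⟨k, hT r hr k h1, fun h => by rw [h] at h1; exact lt_irrefl _ h1, h2⟩
      · push Not at h
        obtain ⟨k, hk, hkr⟩ := Finset.exists_mem_ne (by omega : 1 < T.card) r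
        have : (0 : ℝ) < m := by exact_mod_cast hm
        exact ⟨k, hk, hkr, by linarith [h k]⟩
    have : shiftsAbove m Finset.univ x (x r) ⊂ T.erase r ×ˢ Finset.Icc (1 : ℤ) m := by
      rw [Finset.ssubset_iff_of_subset (hsub T hT r hr)]
      refine ⟨(k, (m : ℤ)), ?_, fun h => ?_⟩
      · simp only [Finset.mem_product, Finset.mem_erase, Finset.mem_Icc]
        exact ⟨⟨hkr, hk⟩, by omega, le_rfl⟩
      · have := (mem_shiftsAbove.1 h).2.2.2
        rw [Int.cast_natCast] at this
        linarith
    exact_mod_cast Finset.card_lt_card this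

/-! ### Every prime `m`-Catalan function is a label -/

/-- If the `p`-center is larger than `T`, some element outside `T` has a small value. -/
theorem exists_notMem_le_of_card_lt {n : ℕ} {p : ℤ} {a : Fin n → ℕ} {T : Finset (Fin n)}
    (h : T.card < centerCard p a) :
    ∃ s ∉ T, (a s : ℤ) ≤ p + 1 + ((T.filter (fun k => s < k)).card : ℤ) := by
  classical
  have hne : (center p a \ T).Nonempty := by
    rw [Finset.sdiff_nonempty]
    exact fun hsub => (Finset.card_le_card hsub).not_gt h
  -- With `s` the largest index of the center outside `T`, every larger index of the center belongs
  -- to `T`.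
  obtain ⟨s, hs, hmax⟩ := Finset.exists_max_image _ id hne
  obtain ⟨hsc, hsT⟩ := Finset.mem_sdiff.1 hs
  refine ⟨s, hsT, ((isGreatest_center p a).1 s hsc).trans ?_⟩
  have : (center p a).filter (fun y => s ≤ y) ⊆ insert s (T.filter (fun k => s < k)) := by
    intro k hk
    obtain ⟨hkc, hsk⟩ := Finset.mem_filter.1 hk
    rcases hsk.eq_or_lt with rfl | hlt
    · exact Finset.mem_insert_self _ _
    · refine Finset.mem_insert_of_mem (Finset.mem_filter.2 ⟨?_, hlt⟩)
      by_contra hkT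
      exact (hmax k (Finset.mem_sdiff.2 ⟨hkc, hkT⟩)).not_gt hlt
  have := (Finset.card_le_card this).trans (Finset.card_insert_le _ _)
  omega

/-- The elements of `T` are placed at generic positions `x k ≥ y`, with consecutive gaps less than
`m`, so that their labels are given by `a`, and no other element placed just below `y` would
have a label exceeding its value under `a`. -/
structure IsPartialPlacement {n : ℕ} (m : ℕ) (a : Fin n → ℕ) (T : Finset (Fin n))
    (x : Fin n → ℝ) (y : ℝ) : Prop where
  le : ∀ k ∈ T, y ≤ x k
  generic : ∀ k ∈ T, ∀ l ∈ T, k ≠ l → ∀ c : ℤ, x k - x l ≠ c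
  gap : ∀ r ∈ T, (∃ k ∈ T, x r < x k) → ∃ k ∈ T, x r < x k ∧ x k < x r + m
  label : ∀ r ∈ T, a r = 1 + (shiftsAbove m T x (x r)).card +
    (T.filter (fun k => r < k ∧ x r < x k)).card
  bound : ∀ s ∉ T, 1 + (shiftsAbove m T x y).card + (T.filter (fun k => s < k)).card ≤ a s

-- Including the shift `b = 0` lets a single count over `T × [0, m]` control both how many points
-- and how many proper shifts lie above `y`.
open Finset in
theorem card_filter_product_Icc {n m : ℕ} (T : Finset (Fin n)) (x : Fin n → ℝ) (y : ℝ) :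
    ((T ×ˢ Icc (0 : ℤ) m).filter (fun q => y < x q.1 - q.2)).card =
      (T.filter (fun k => y < x k)).card + (shiftsAbove m T x y).card := by
  classical
  have h : (T ×ˢ Icc (0 : ℤ) m).filter (fun q => y < x q.1 - q.2) =
      (T.filter (fun k => y < x k)).image (fun k => (k, (0 : ℤ))) ∪ shiftsAbove m T x y := by
    ext ⟨k, b⟩
    simp only [mem_filter, mem_product, mem_Icc, mem_union, mem_image, mem_shiftsAbove,
      Prod.mk.injEq]
    constructor
    · rintro ⟨⟨hk, h0, h1⟩, h2⟩
      rcases h0.eq_or_lt with rfl | h0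
      · left; exact ⟨k, ⟨hk, by simpa using h2⟩, rfl, rfl⟩
      · right; exact ⟨hk, h0, h1, h2⟩
    · rintro (⟨k, ⟨hk, h⟩, rfl, rfl⟩ | ⟨hk, h0, h1, h2⟩)
      · exact ⟨⟨hk, le_rfl, by omega⟩, by simpa using h⟩
      · exact ⟨⟨hk, by omega, h1⟩, h2⟩
  rw [h, card_union_of_disjoint, card_image_of_injective]
  · intro k l hkl; exact (Prod.mk.inj hkl).1
  · rw [disjoint_left]
    intro q hq hq'
    obtain ⟨k, -, rfl⟩ := mem_image.1 hq
    have := (mem_shiftsAbove.1 hq').2.1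
    simp at this

/-- The number of shifts above a point just below all `x k` can be prescribed. -/
theorem IsPartialPlacement.exists_position {n m : ℕ} {a : Fin n → ℕ} {T : Finset (Fin n)}
    {x : Fin n → ℝ} {y : ℝ} (h : IsPartialPlacement m a T x y) {N : ℕ}
    (hN : (shiftsAbove m T x y).card ≤ N) (hN' : N ≤ T.card * m) :
    ∃ z, (∀ k, ∀ c : ℤ, x k - z ≠ c) ∧ (∀ k ∈ T, z < x k) ∧ (shiftsAbove m T x z).card = N := by
  classical
  have hinj : Set.InjOn (fun q : Fin n × ℤ => x q.1 - q.2)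
      (T ×ˢ Finset.Icc (0 : ℤ) m : Finset (Fin n × ℤ)) := by
    rintro ⟨k, b⟩ hk ⟨l, c⟩ hl he
    simp only [Finset.coe_product, Set.mem_prod, Finset.mem_coe] at hk hl
    simp only at he
    by_cases hkl : k = l
    · subst hkl
      have : (b : ℝ) = c := by linarith
      rw [Prod.mk.injEq]
      exact ⟨rfl, by exact_mod_cast this⟩
    · refine (h.generic k hk.1 l hl.1 hkl (b - c) ?_).elim
      push_cast; linarith
  have hB : (⋃ k : Fin n, Set.range (fun c : ℤ => x k - c)).Countable :=
    Set.countable_iUnion fun k => Set.countable_range _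
  -- If some `x k ≤ z`, then fewer than `|T|` unshifted points lie above `z`, and at most `N` shifts
  -- do because `z ≥ y`; the total `|T| + N` rules this out. So all of `T` lies above `z`, leaving
  -- exactly `N` proper shifts.
  obtain ⟨z, hz, hcard⟩ := exists_card_filter_lt_eq _ hinj hB (T.card + N) (by
    rw [Finset.card_product, Int.card_Icc]
    have : ((m : ℤ) + 1 - 0).toNat = m + 1 := by omega
    rw [this]; ring_nf; omega)
  rw [card_filter_product_Icc] at hcard
  have hlt : ∀ k ∈ T, z < x k := by
    intro k hk
    by_contra hkz
    have h1 : (T.filter (fun k => z < x k)).card < T.card :=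
      Finset.card_lt_card (Finset.filter_ssubset.2 ⟨k, hk, hkz⟩)
    have h2 : shiftsAbove m T x z ⊆ shiftsAbove m T x y := by
      intro q hq
      rw [mem_shiftsAbove] at hq ⊢
      exact ⟨hq.1, hq.2.1, hq.2.2.1, by linarith [h.le k hk, hq.2.2.2]⟩
    have := Finset.card_le_card h2
    omega
  refine ⟨z, fun k c hc => hz (Set.mem_iUnion.2 ⟨k, c, ?_⟩), hlt, ?_⟩
  · simp only; linarith
  · rw [Finset.filter_true_of_mem hlt] at hcard
    omega

/-- Shifts of a point at `z` by `b ≥ 1` fall strictly below `z`. This is why adding a lowest point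
leaves the shift counts of the earlier ones unchanged. -/
theorem shiftsAbove_insert_update {n m : ℕ} {T : Finset (Fin n)} {x : Fin n → ℝ} {s : Fin n}
    (hs : s ∉ T) {z w : ℝ} (hzw : z ≤ w) :
    shiftsAbove m (insert s T) (Function.update x s z) w = shiftsAbove m T x w := by
  ext ⟨k, b⟩
  simp only [mem_shiftsAbove, Finset.mem_insert]
  constructor
  · rintro ⟨rfl | hk, h1, h2, h3⟩
    · have : (1 : ℝ) ≤ (b : ℝ) := by exact_mod_cast h1
      rw [Function.update_self] at h3
      linarith
    · rw [Function.update_of_ne (ne_of_mem_of_not_mem hk hs)] at h3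
      exact ⟨hk, h1, h2, h3⟩
  · rintro ⟨hk, h1, h2, h3⟩
    rw [Function.update_of_ne (ne_of_mem_of_not_mem hk hs)]
    exact ⟨Or.inr hk, h1, h2, h3⟩

/-- A partial placement of a proper subset can be extended by one element. -/
theorem IsPartialPlacement.exists_insert {n m : ℕ} {a : Fin n → ℕ}
    (ha : IsPrimeCatalanFunction m a) {T : Finset (Fin n)} {x : Fin n → ℝ} {y : ℝ}
    (h : IsPartialPlacement m a T x y) (hT : T.card < n) :
    ∃ s ∉ T, ∃ z, IsPartialPlacement m a (insert s T) (Function.update x s z) z := by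
  classical
  -- For empty `T` the truncated subtraction gives `0`, and the bound `a t ≤ 1` comes from the
  -- Catalan condition at `i = 1`. Otherwise the prime condition at `i = |T| + 1` applies.
  obtain ⟨t, ht, hta⟩ : ∃ t ∉ T, a t ≤ 1 + (T.card * m - 1) + (T.filter (fun k => t < k)).card ∧
      (T.Nonempty → 0 < T.card * m) := by
    rcases T.eq_empty_or_nonempty with rfl | hne
    · obtain ⟨t, ht, h1⟩ := exists_notMem_le_of_card_lt (T := ∅) (ha.1.2 1 le_rfl (by simp at hT; omega))
      refine ⟨t, ht, ?_, by simp⟩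
      simp at h1 ⊢
      omega
    · have h0 : 0 < T.card := hne.card_pos
      obtain ⟨t, ht, h1⟩ := exists_notMem_le_of_card_lt (T := T) (ha.2 (T.card + 1) (by omega) hT)
      push_cast at h1
      have h2 := h.bound t ht
      have h3 : 0 < T.card * m := by
        by_contra hcon
        have h4 : (T.card : ℤ) * m = 0 := by exact_mod_cast Nat.eq_zero_of_not_pos hcon
        rw [add_sub_cancel_right, h4] at h1
        omega
      refine ⟨t, ht, ?_, fun _ => h3⟩
      rw [add_sub_cancel_right] at h1
      have h4 : ((T.card * m : ℕ) : ℤ) = (T.card : ℤ) * m := by push_cast; rfl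
      omega
  obtain ⟨hta, hpos⟩ := hta
  -- `N` is the least number of shifts still required by an unplaced element; `h.bound` shows that
  -- the subtraction does not truncate.
  obtain ⟨t', ht', hmin⟩ := Finset.exists_min_image Tᶜ
    (fun s => a s - (1 + (T.filter (fun k => s < k)).card)) ⟨t, by simpa using ht⟩
  obtain ⟨N, hNdef⟩ : ∃ N, N = a t' - (1 + (T.filter (fun k => t' < k)).card) := ⟨_, rfl⟩
  simp only [← hNdef, Finset.mem_compl] at hmin ht'
  have hle : ∀ s ∉ T, 1 + N + (T.filter (fun k => s < k)).card ≤ a s := by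
    intro s hs
    have h1 := hmin s hs
    have h2 := h.bound s hs
    omega
  have hcN : (shiftsAbove m T x y).card ≤ N := by
    have := h.bound t' ht'
    omega
  have hN : N ≤ T.card * m - 1 := by
    have := hle t ht
    omega
  -- Ties are broken by the smallest index: placing `s` adds one to the label of every unplaced `r <
  -- s`, so such an `r` must not attain the minimum.
  obtain ⟨s, hs, hsmin⟩ := Finset.exists_min_image
    (Tᶜ.filter (fun s => a s = 1 + N + (T.filter (fun k => s < k)).card)) id
    ⟨t', by
      have := h.bound t' ht'
      simp only [Finset.mem_filter, Finset.mem_compl]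
      exact ⟨ht', by omega⟩⟩
  simp only [Finset.mem_filter, Finset.mem_compl, id] at hs hsmin
  obtain ⟨hsT, hsa⟩ := hs
  obtain ⟨z, hgen, hzlt, hzN⟩ := h.exists_position hcN (by omega)
  have hxs : Function.update x s z s = z := Function.update_self ..
  have hxk : ∀ k ∈ T, Function.update x s z k = x k := fun k hk =>
    Function.update_of_ne (ne_of_mem_of_not_mem hk hsT) _ _
  refine ⟨s, hsT, z, ?_, ?_, ?_, ?_, ?_⟩
  · intro k hk
    rw [Finset.mem_insert] at hk
    rcases hk with rfl | hk
    · rw [hxs]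
    · rw [hxk k hk]; exact (hzlt k hk).le
  · intro k hk l hl hkl c hc
    rw [Finset.mem_insert] at hk hl
    rcases hk with rfl | hk <;> rcases hl with rfl | hl
    · exact hkl rfl
    · rw [hxs, hxk l hl] at hc
      exact hgen l (-c) (by push_cast; linarith)
    · rw [hxs, hxk k hk] at hc
      exact hgen k c hc
    · rw [hxk k hk, hxk l hl] at hc
      exact h.generic k hk l hl hkl c hc
  · intro r hr hrk
    rw [Finset.mem_insert] at hr
    rcases hr with rfl | hr
    · obtain ⟨k, hk, hkr⟩ := hrk
      have hkT : k ∈ T := by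
        rw [Finset.mem_insert] at hk
        rcases hk with rfl | hk
        · exact absurd hkr (lt_irrefl _)
        · exact hk
      have h0 := hpos ⟨k, hkT⟩
      -- Since `N < |T| m`, some shift `x l - b` is not above `z`, whence `x l ≤ z + m`; genericity
      -- makes this strict.
      have hex : ∃ q ∈ T ×ˢ Finset.Icc (1 : ℤ) m, ¬ z < x q.1 - q.2 := by
        by_contra! hcon
        have : (shiftsAbove m T x z).card = T.card * m := by
          rw [shiftsAbove, Finset.filter_true_of_mem hcon, Finset.card_product, Int.card_Icc]
          simp
        omega
      obtain ⟨⟨l, b⟩, hq, hqz⟩ := hex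
      rw [Finset.mem_product, Finset.mem_Icc] at hq
      refine ⟨l, Finset.mem_insert_of_mem hq.1, ?_⟩
      rw [hxs, hxk l hq.1]
      refine ⟨hzlt l hq.1, lt_of_le_of_ne ?_ ?_⟩
      · have : (b : ℝ) ≤ m := by exact_mod_cast hq.2.2
        simp only [not_lt] at hqz
        linarith
      · intro he
        exact hgen l m (by push_cast; linarith)
    · obtain ⟨k, hk, hkr⟩ := hrk
      rw [hxk r hr] at hkr ⊢
      have hkT : k ∈ T := by
        rw [Finset.mem_insert] at hk
        rcases hk with rfl | hk
        · rw [hxs] at hkr; linarith [hzlt r hr]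
        · exact hk
      rw [hxk k hkT] at hkr
      obtain ⟨l, hl, hl'⟩ := h.gap r hr ⟨k, hkT, hkr⟩
      exact ⟨l, Finset.mem_insert_of_mem hl, by rwa [hxk l hl]⟩
  · intro r hr
    rw [Finset.mem_insert] at hr
    rcases hr with rfl | hr
    · rw [hxs, shiftsAbove_insert_update hsT le_rfl, hzN, hsa]
      congr 2
      ext k
      simp only [Finset.mem_filter, Finset.mem_insert]
      constructor
      · rintro ⟨hk, hrk⟩
        exact ⟨Or.inr hk, hrk, by rw [hxk k hk]; exact hzlt k hk⟩
      · rintro ⟨rfl | hk, hrk, -⟩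
        · exact absurd hrk (lt_irrefl _)
        · exact ⟨hk, hrk⟩
    · rw [hxk r hr, shiftsAbove_insert_update hsT (hzlt r hr).le, h.label r hr]
      congr 2
      ext k
      simp only [Finset.mem_filter, Finset.mem_insert]
      constructor
      · rintro ⟨hk, hrk, hx⟩
        exact ⟨Or.inr hk, hrk, by rwa [hxk k hk]⟩
      · rintro ⟨rfl | hk, hrk, hx⟩
        · rw [hxs] at hx; linarith [hzlt r hr]
        · exact ⟨hk, hrk, by rwa [hxk k hk] at hx⟩
  · intro r hr
    rw [Finset.mem_insert, not_or] at hr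
    rw [shiftsAbove_insert_update hsT le_rfl, hzN, Finset.filter_insert]
    have h1 := hle r hr.2
    -- For `r < s` the extra unit is available because `r` exceeds the minimum by at least one; for
    -- other `r` the count is unchanged.
    split_ifs with hrs
    · rw [Finset.card_insert_of_notMem (by simp [hsT])]
      by_contra hcon
      exact (hsmin r ⟨hr.2, by omega⟩).not_gt hrs
    · exact h1

theorem IsPrimeCatalanFunction.exists_gapsLT {n m : ℕ} {a : Fin n → ℕ}
    (ha : IsPrimeCatalanFunction m a) :
    ∃ x : Fin n → ℝ, (∀ k l, k ≠ l → ∀ c : ℤ, x k - x l ≠ c) ∧ GapsLT m x ∧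
      ∀ r, a r = 1 + (shiftsAbove m Finset.univ x (x r)).card +
        (Finset.univ.filter (fun k => r < k ∧ x r < x k)).card := by
  have hstep : ∀ i ≤ n, ∃ T x y, T.card = i ∧ IsPartialPlacement m a T x y := by
    intro i
    induction i with
    | zero =>
      -- For the empty placement, `bound` is exactly the positivity of `a`.
      refine fun _ => ⟨∅, 0, 0, rfl, by simp, by simp, by simp, by simp, fun s _ => ?_⟩
      simpa [shiftsAbove] using ha.1.1 s
    | succ i ih =>
      intro hi
      obtain ⟨T, x, y, hcard, h⟩ := ih (by omega)
      obtain ⟨s, hs, z, hz⟩ := h.exists_insert ha (by omega)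
      exact ⟨_, _, _, by rw [Finset.card_insert_of_notMem hs, hcard], hz⟩
  obtain ⟨T, x, y, hcard, h⟩ := hstep n le_rfl
  obtain rfl : T = Finset.univ := by
    rw [← Finset.card_eq_iff_eq_univ, hcard, Fintype.card_fin]
  refine ⟨x, fun k l => h.generic k (Finset.mem_univ k) l (Finset.mem_univ l), fun r hr => ?_,
    fun r => h.label r (Finset.mem_univ r)⟩
  simpa using h.gap r (Finset.mem_univ r) (by simpa using hr)

end MCatalan

/-! ### Equality of the two sets -/

theorem mainTheorem3 (n m : ℕ) (hn : 0 < n) (hm : 0 < m) :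
    {a : Fin n → ℕ | ∃ R ∈ MCatalan.regions (MCatalan.catalan n m),
        MCatalan.IsRelativelyBounded R ∧
          MCatalan.pakStanleyLabel (MCatalan.catalan n m) R = a} =
      {a : Fin n → ℕ | MCatalan.IsPrimeCatalanFunction m a} := by
  ext a
  constructor
  · rintro ⟨_, ⟨x, hx, rfl⟩, hR, rfl⟩
    refine MCatalan.isPrimeCatalanFunction_of_gapsLT hm (fun k l hkl => ?_)
      (MCatalan.gapsLT_of_isRelativelyBounded hx hR) (MCatalan.pakStanleyLabel_component hm hx)
    by_contra hne
    exact MCatalan.mem_complement_catalan.1 hx k l hne 0 (by omega) (by omega) (by simp [hkl])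
  · intro ha
    obtain ⟨x, hgen, hgap, hlabel⟩ := MCatalan.IsPrimeCatalanFunction.exists_gapsLT ha
    have hx : x ∈ MCatalan.complement (MCatalan.catalan n m) :=
      MCatalan.mem_complement_catalan.2 fun k l hkl c _ _ => hgen k l hkl c
    refine ⟨_, ⟨x, hx, rfl⟩, MCatalan.isRelativelyBounded_of_gapsLT hx hgap, ?_⟩
    funext r
    rw [MCatalan.pakStanleyLabel_component hm hx, hlabel r]
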